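/- Let $n\ge 3$. Work in Artin's braid group $B_n$ with standard generators $\sigma_1,\dots,\sigma_{n-1}$. For $1\le p<q\le n$ put $a_{p,q}=\sigma_p\cdots\sigma_{q-2}\,\sigma_{q-1}\,\sigma_{q-2}^{-1}\cdots\sigma_p^{-1}$, and for $2\le m\le n$ let $B_m^{+*}$ be the submonoid of $B_n$ generated by the $a_{p,q}$ with $1\le p<q\le m$. Put $\delta_m=\sigma_1\cdots\sigma_{m-1}$ and let $\phi_m(\beta)=\delta_m\beta\delta_m^{-1}$; on letters, $\phi_m(a_{p,q})=a_{p+1,q+1}$ for $q<m$ and $\phi_m(a_{p,m})=a_{1,p+1}$. For $m\ge3$ and $\beta\in B_m^{+*}$, the $B_{m-1}^{+*}$-tail of $\beta$ is the right-divisor $\tau\in B_{m-1}^{+*}$ of $\beta$ in $B_m^{+*}$ such that $\beta\tau^{-1}$ has no nontrivial right-divisor lying in $B_{m-1}^{+*}$. The $\phi_m$-splitting of a nontrivial $\beta\in B_m^{+*}$ is the sequence $(\beta_b,\dots,\beta_1)$ in $B_{m-1}^{+*}$ with $\beta_b\ne1$, $\beta=\phi_m^{b-1}(\beta_b)\cdots\phi_m(\beta_2)\,\beta_1$,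 and such that for each $1\le k\le b$ the braid $\beta_k$ is the $B_{m-1}^{+*}$-tail of $\phi_m^{b-k}(\beta_b)\cdots\phi_m(\beta_{k+1})\,\beta_k$ (the splitting of $1$ is empty). The (rotating) normal form of $\beta\in B_2^{+*}$ is the word $a_{1,2}^k$ representing $\beta$; for $m\ge3$ the normal form of $\beta\in B_m^{+*}$ with $\phi_m$-splitting $(\beta_b,\dots,\beta_1)$ is the word $\phi_m^{b-1}(w_b)\cdots\phi_m(w_2)\,w_1$, where $w_j$ is the normal form of $\beta_j$ in $B_{m-1}^{+*}$. A word is normal if it is the normal form of the braid it represents. For $\beta\neq 1$, $\beta^\#$ denotes the last letter of the normal form of $\beta$. A letter $a_{r,s}$ is an $a_{p,n}$-barrier if $1\le r<p<s\le n-1$. A normal word $w$ of $B_{n-1}^{+*}$ is an $a_{p,n}$-ladder of height $h\geq 0$ lent on $a_{q-1,n-1}$ if its last letter is $a_{q-1,n-1}$ and there are a decomposition $w=w_0x_1w_1\cdots x_hw_h$ into letters $x_k$ and words $w_k$, and integers $p=f(0)<f(1)<\dots<f(h)=n-1$, such that for $1\le k\le h$ the letter $x_k$ is an $a_{f(k-1),n}$-barrier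 of the form $a_{r,f(k)}$, and for $0\le k<h$ the word $w_k$ contains no $a_{f(k),n}$-barrier. **Statement.** Let $(\beta_b,\dots,\beta_1)$ be the $\phi_n$-splitting of some braid of $B_n^{+*}$, and let $2\le k\le b-1$. Then the normal form of $\beta_{k+1}$ is nonempty and $\phi_n(\beta_{k+1}^\#)=a_{p,n}$ for some $p$. If $\beta_k\ne1$, the normal form of $\beta_k$ is an $a_{p,n}$-ladder (of some height) lent on its own last letter $\beta_k^\#$. If $\beta_k=1$, then $k=2$ and $p=n-1$ (so the normal form of $\beta_k$ is the empty word, a ladder of height $0$ without a last letter). -/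

import Mathlib

noncomputable section

namespace DualBraid

/-- Artin's relators: `σ_i σ_j = σ_j σ_i` for `|i - j| ≥ 2` and `σ_i σ_j σ_i = σ_j σ_i σ_j` for
`|i - j| = 1`. The element `i : Fin (n - 1)` stands for the generator `σ_{i+1}`. -/
def artinRels (n : ℕ) : Set (FreeGroup (Fin (n - 1))) :=
  {r | ∃ i j : Fin (n - 1), (i : ℕ) + 2 ≤ (j : ℕ) ∧
      r = (FreeGroup.of i * FreeGroup.of j) * (FreeGroup.of j * FreeGroup.of i)⁻¹} ∪
  {r | ∃ i j : Fin (n - 1), (i : ℕ) + 1 = (j : ℕ) ∧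
      r = (FreeGroup.of i * FreeGroup.of j * FreeGroup.of i) *
        (FreeGroup.of j * FreeGroup.of i * FreeGroup.of j)⁻¹}

/-- Artin's braid group `B_n`. -/
abbrev BraidGroup (n : ℕ) : Type := PresentedGroup (artinRels n)

/-- The Artin generator `σ_i` of `B_N` for `1 ≤ i ≤ N - 1` (by convention `1` for other `i`,
a case that never occurs below). -/
def sigma (N i : ℕ) : BraidGroup N :=
  if h : 1 ≤ i ∧ i < N then PresentedGroup.of (⟨i - 1, by omega⟩ : Fin (N - 1)) else 1

/-- A letter `a_{p,q}` with `1 ≤ p < q`; here `p = lo` and `q = hi`. -/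
@[ext]
structure ALetter where
  lo : ℕ
  hi : ℕ
  one_le_lo : 1 ≤ lo
  lo_lt_hi : lo < hi

/-- The letter `a_{1,2}`. -/
def a12 : ALetter := ⟨1, 2, le_refl 1, Nat.lt_succ_self 1⟩

/-- The Birman-Ko-Lee braid
`a_{p,q} = σ_p ⋯ σ_{q-2} σ_{q-1} σ_{q-2}⁻¹ ⋯ σ_p⁻¹` of `B_N` (meaningful for `q ≤ N`). -/
def aBraid (N : ℕ) (a : ALetter) : BraidGroup N :=
  ((List.range' a.lo (a.hi - 1 - a.lo)).map (sigma N)).prod * sigma N (a.hi - 1) *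
    ((List.range' a.lo (a.hi - 1 - a.lo)).map (sigma N)).prod⁻¹

/-- The braid of `B_N` represented by a positive word in the letters `a_{p,q}`. -/
def wordBraid (N : ℕ) (w : List ALetter) : BraidGroup N := (w.map (aBraid N)).prod

/-- The dual braid monoid on `m` strands, for `m ≤ N`, as a submonoid of `B_N`: it is generated by
the braids `a_{p,q}` with `1 ≤ p < q ≤ m`. -/
def dualMonoid (N m : ℕ) : Submonoid (BraidGroup N) :=
  Submonoid.closure {x | ∃ a : ALetter, a.hi ≤ m ∧ x = aBraid N a}

/-- The Garside element `δ_m = σ_1 σ_2 ⋯ σ_{m-1}`, viewed in `B_N`. -/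
def delta (N m : ℕ) : BraidGroup N := ((List.range' 1 (m - 1)).map (sigma N)).prod

/-- The rotating automorphism `ϕ_m`, characterised by `δ_m β = ϕ_m(β) δ_m`. -/
def rot (N m : ℕ) (β : BraidGroup N) : BraidGroup N := delta N m * β * (delta N m)⁻¹

/-- The rotation `ϕ_m` on letters: `a_{p,q} ↦ a_{p+1,q+1}` for `q ≤ m - 1` and
`a_{p,m} ↦ a_{1,p+1}`. -/
def ALetter.rot (m : ℕ) (a : ALetter) : ALetter :=
  if a.hi < m then ⟨a.lo + 1, a.hi + 1, by omega, Nat.succ_lt_succ a.lo_lt_hi⟩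
  else ⟨1, a.lo + 1, le_refl 1, Nat.lt_succ_of_le a.one_le_lo⟩

/-- `τ` is the tail of `β` in the dual monoid on `m - 1` strands, where `β` lies in the dual monoid
on `m` strands: `τ` is the right-divisor of `β` lying in the smaller monoid such that the quotient
`β τ⁻¹` has no nontrivial right-divisor lying in the smaller monoid. -/
def IsTail (N m : ℕ) (β τ : BraidGroup N) : Prop :=
  τ ∈ dualMonoid N (m - 1) ∧
    ∃ γ ∈ dualMonoid N m, β = γ * τ ∧
      ∀ γ' ∈ dualMonoid N m, ∀ ρ ∈ dualMonoid N (m - 1), γ = γ' * ρ → ρ = 1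

/-- The product `ϕ_m^{b-k}(β_b) ⋯ ϕ_m(β_{k+1}) β_k`. -/
def rotProd (N m b : ℕ) (β : ℕ → BraidGroup N) (k : ℕ) : BraidGroup N :=
  ((List.range' k (b + 1 - k)).reverse.map fun j => (rot N m)^[j - k] (β j)).prod

/-- `(β_b, …, β_1)` is the `ϕ_m`-splitting of the braid `x` (of the dual monoid on `m` strands).
Only the values `β_1, …, β_b` of `β` matter. The splitting of the trivial braid is the empty
sequence. -/
structure IsSplitting (N m : ℕ) (x : BraidGroup N) (b : ℕ) (β : ℕ → BraidGroup N) : Prop where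
  mem : ∀ k, 1 ≤ k → k ≤ b → β k ∈ dualMonoid N (m - 1)
  ne_one : 1 ≤ b → β b ≠ 1
  eq_prod : x = rotProd N m b β 1
  isTail : ∀ k, 1 ≤ k → k ≤ b → IsTail N m (rotProd N m b β k) (β k)

open Classical in
/-- The rotating normal form of a braid of the dual monoid on `m` strands (with `2 ≤ m ≤ N`): for
`m = 2` it is the word `a_{1,2}^k` representing the braid; for `m ≥ 3` it is
`ϕ_m^{b-1}(w_b) ⋯ ϕ_m(w_2) w_1` where `(β_b, …, β_1)` is the `ϕ_m`-splitting of the braid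
and `w_j` is the normal form of `β_j` on `m - 1` strands. -/
def normalForm (N : ℕ) : ℕ → BraidGroup N → List ALetter
  | 0, _ => []
  | 1, _ => []
  | 2, x =>
    if h : ∃ k : ℕ, x = aBraid N a12 ^ k then List.replicate h.choose a12 else []
  | m + 3, x =>
    if h : ∃ s : ℕ × (ℕ → BraidGroup N), IsSplitting N (m + 3) x s.1 s.2 then
      ((List.range' 1 h.choose.1).reverse.map fun j =>
        (normalForm N (m + 2) (h.choose.2 j)).map (ALetter.rot (m + 3))^[j - 1]).flatten
    else []

/-- A positive `m`-strand word is normal if it is the normal form of the braid it represents. -/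
def IsNormalWord (N m : ℕ) (w : List ALetter) : Prop :=
  (∀ a ∈ w, a.hi ≤ m) ∧ normalForm N m (wordBraid N w) = w

/-- The letter `a_{r,s}` is an `a_{p,n}`-barrier: `1 ≤ r < p < s ≤ n - 1`. -/
def IsBarrier (n p : ℕ) (a : ALetter) : Prop :=
  1 ≤ a.lo ∧ a.lo < p ∧ p < a.hi ∧ a.hi ≤ n - 1

/-- The normal word `w` on `n - 1` strands is an `a_{p,n}`-ladder of height `h` lent on the letter
`y`, where `y` has the form `a_{q-1,n-1}`. The words `w_0, …, w_h` are `u 0, …, u h`. For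
`p = n - 1` the height is necessarily `0`, and only the condition on the last letter is left. -/
def IsLadder (n p h : ℕ) (y : ALetter) (w : List ALetter) : Prop :=
  IsNormalWord n (n - 1) w ∧
  ∃ (u : ℕ → List ALetter) (x : ℕ → ALetter) (f : ℕ → ℕ),
    w = u 0 ++ ((List.range' 1 h).map fun k => x k :: u k).flatten ∧
    f 0 = p ∧ f h = n - 1 ∧ (∀ k < h, f k < f (k + 1)) ∧
    (∀ k, 1 ≤ k → k ≤ h → IsBarrier n (f (k - 1)) (x k) ∧ (x k).hi = f k) ∧
    (∀ k < h, ∀ a ∈ u k, ¬ IsBarrier n (f k) a) ∧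
    w.getLast? = some y ∧ y.hi = n - 1

/-- The last letter of the normal form of a braid of the dual monoid on `m` strands (`none` if that
normal form is empty). -/
def lastLetter (N m : ℕ) (x : BraidGroup N) : Option ALetter := (normalForm N m x).getLast?

end DualBraid

end

open DualBraid

/-!
The proof needs no lattice structure on the dual braid monoids, only right divisibility by single
letters. Write `P_k = ϕ_n^{b-k}(β_b) ⋯ ϕ_n(β_{k+1}) β_k`, so that `P_k = ϕ_n(P_{k+1}) β_k`. The
tail condition says that `ϕ_n(P_{k+1})` ends only with letters `a_{p,n}`. Applied one step lower,
it says that for `k ≥ 2` the braid `P_k` ends only with letters `a_{p,n-1}` or with `a_{n-1,n}`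
(`IsSplitting.endsWith_rotProd`).

The other ingredient is a forward computation with the Birman–Ko–Lee relations
(`exists_endsWith_of_no_barrier`). Fix `s`. If a word on `n - 1` strands contains no
`a_{s,n}`-barrier, each of its letters lives on the strands `1, …, s` or on the strands
`s, …, n - 1`. A letter which is `a_{s,n}` or lives on the strands `1, …, s` can be moved
unchanged across a letter of the second sort, and may be replaced by a letter of the first sort
when it meets one. So the product of such a letter with the word ends with a letter of the same
kind. For `s < n - 1` this is one of the endings excluded for `P_k`.

Hence, for any word of `β_k`: every letter `a_{r,s}` with `s < n - 1` is followed by an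
`a_{s,n}`-barrier, and, since `ϕ_n(P_{k+1})` ends with `a_{p,n} = ϕ_n(β_{k+1}^#)`, the word contains
an `a_{p,n}`-barrier unless `p = n - 1` (`IsSplitting.exists_barrier`). Hopping from each barrier
`a_{r,s}` to the first subsequent `a_{s,n}`-barrier gives the rungs of the ladder
(`exists_ladder_decomposition`). The same argument with `s = 1`, where barriers do not exist, shows
that `β_j ≠ 1` for `3 ≤ j ≤ b` (`IsSplitting.entry_ne_one`).

That normal forms represent their braids (`normalForm_spec`) comes down to the existence of
splittings (`exists_isSplitting`), proved by induction on the length, a homomorphic invariant. No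
uniqueness of tails or splittings is required, as the normal form of a braid is a fixed choice.
-/

noncomputable section

namespace DualBraid

/-! ### Products of consecutive Artin generators and the Birman–Ko–Lee relations -/

/-- The product `σ_p σ_{p+1} ⋯ σ_{q-1}` of `B_N` (equal to `1` for `q ≤ p`). -/
def run (N p q : ℕ) : BraidGroup N := ((List.range' p (q - p)).map (sigma N)).prod

lemma run_self (N p : ℕ) : run N p p = 1 := by simp [run]

lemma run_mul_run (N : ℕ) {p q r : ℕ} (hpq : p ≤ q) (hqr : q ≤ r) :
    run N p q * run N q r = run N p r := by
  have h := List.range'_append_1 (s := p) (m := q - p) (n := r - q)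
  rw [show p + (q - p) = q by omega, show q - p + (r - q) = r - p by omega] at h
  simp only [run, ← List.prod_append, ← List.map_append, h]

lemma run_succ (N p : ℕ) : run N p (p + 1) = sigma N p := by simp [run]

lemma sigma_comm (N : ℕ) {i j : ℕ} (h : i + 2 ≤ j) : Commute (sigma N i) (sigma N j) := by
  unfold sigma
  split_ifs with hi hj
  · have := PresentedGroup.one_of_mem (rels := artinRels N) (Or.inl
      ⟨⟨i - 1, by omega⟩, ⟨j - 1, by omega⟩, by simp only; omega, rfl⟩)
    rw [map_mul, map_inv, mul_inv_eq_one, map_mul, map_mul] at this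
    exact this
  all_goals simp

lemma sigma_braid (N : ℕ) {i : ℕ} (h1 : 1 ≤ i) (h2 : i + 1 < N) :
    sigma N i * sigma N (i + 1) * sigma N i = sigma N (i + 1) * sigma N i * sigma N (i + 1) := by
  unfold sigma
  rw [dif_pos ⟨h1, by omega⟩, dif_pos ⟨by omega, h2⟩]
  have := PresentedGroup.one_of_mem (rels := artinRels N) (Or.inr
      ⟨⟨i - 1, by omega⟩, ⟨i + 1 - 1, by omega⟩, by simp only; omega, rfl⟩)
  rw [map_mul, map_inv, mul_inv_eq_one, map_mul, map_mul, map_mul, map_mul] at this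
  exact this

lemma run_commute_sigma (N : ℕ) {p q i : ℕ} (h : ∀ j, p ≤ j → j < q → j + 2 ≤ i ∨ i + 2 ≤ j) :
    Commute (run N p q) (sigma N i) := by
  unfold run
  apply Commute.list_prod_left
  intro x hx
  obtain ⟨j, hj, rfl⟩ := List.mem_map.1 hx
  rw [List.mem_range'_1] at hj
  rcases h j hj.1 (by omega) with h | h
  · exact sigma_comm N h
  · exact (sigma_comm N h).symm

lemma run_commute_run (N : ℕ) {p q r s : ℕ} (h : q < r) :
    Commute (run N p q) (run N r s) := by
  conv_rhs => unfold run
  apply Commute.list_prod_right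
  intro x hx
  obtain ⟨j, hj, rfl⟩ := List.mem_map.1 hx
  rw [List.mem_range'_1] at hj
  exact run_commute_sigma N fun i _ _ => by omega

lemma run_mul_sigma (N : ℕ) {p m i : ℕ} (hp : 1 ≤ p) (hm : m ≤ N) (hpi : p ≤ i) (him : i + 1 < m) :
    run N p m * sigma N i = sigma N (i + 1) * run N p m := by
  have h1 : run N p m = run N p i * (sigma N i * sigma N (i + 1)) * run N (i + 2) m := by
    rw [← run_succ, ← run_succ, run_mul_run N (by omega) (by omega),
      run_mul_run N (by omega) (by omega), run_mul_run N (by omega) (by omega)]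
  have h2 : Commute (run N (i + 2) m) (sigma N i) := run_commute_sigma N fun j _ _ => by omega
  have h3 : Commute (run N p i) (sigma N (i + 1)) := run_commute_sigma N fun j _ _ => by omega
  have h4 := sigma_braid N (i := i) (by omega) (by omega)
  rw [h1, mul_assoc, h2.eq, ← mul_assoc, mul_assoc (run N p i), h4]
  simp only [← mul_assoc]
  rw [h3.eq]

lemma run_mul_run_shift (N : ℕ) {p m i j : ℕ} (hp : 1 ≤ p) (hm : m ≤ N) (hpi : p ≤ i)
    (hjm : j < m) (hij : i ≤ j) :
    run N p m * run N i j = run N (i + 1) (j + 1) * run N p m := by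
  induction j, hij using Nat.le_induction with
  | base => simp [run_self]
  | succ j hij ih =>
    rw [← run_mul_run N hij (Nat.le_succ j), run_succ, ← mul_assoc, ih (by omega), mul_assoc,
      run_mul_sigma N hp hm (by omega) hjm, ← mul_assoc, ← run_succ,
      run_mul_run N (by omega) (by omega)]

/-- `a_{p,q}` with bare indices; it is the trivial braid for `q ≤ p`. -/
def arc (N p q : ℕ) : BraidGroup N := run N p q * (run N p (q - 1))⁻¹

lemma aBraid_eq_arc (N : ℕ) (a : ALetter) : aBraid N a = arc N a.lo a.hi := by
  have h := a.lo_lt_hi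
  have h1 := run_mul_run N (p := a.lo) (q := a.hi - 1) (r := a.hi - 1 + 1) (by omega) (by omega)
  rw [run_succ, show a.hi - 1 + 1 = a.hi by omega] at h1
  rw [arc, ← h1]
  rfl

/-- A second expression of `a_{p,q}`, in which the inverted factor stands on the left. -/
lemma arc_eq' (N : ℕ) {p q : ℕ} (hp : 1 ≤ p) (hpq : p < q) (hq : q ≤ N) :
    arc N p q = (run N (p + 1) q)⁻¹ * run N p q := by
  have h := run_mul_run_shift N hp hq (le_refl p) (j := q - 1) (by omega) (by omega)
  rw [show q - 1 + 1 = q by omega] at h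
  rw [arc, eq_inv_mul_iff_mul_eq, ← mul_assoc, ← h, mul_inv_cancel_right]

lemma arc_commute_of_lt (N : ℕ) {p q r s : ℕ} (hqr : q < r) :
    Commute (arc N p q) (arc N r s) := by
  unfold arc
  exact ((run_commute_run N hqr).mul_right (run_commute_run N hqr).inv_right).mul_left
    ((run_commute_run N (by omega)).mul_right (run_commute_run N (by omega)).inv_right).inv_left

lemma run_mul_arc (N : ℕ) {p m i j : ℕ} (hp : 1 ≤ p) (hm : m ≤ N) (hpi : p ≤ i)
    (hjm : j < m) (hij : i < j) :
    run N p m * arc N i j = arc N (i + 1) (j + 1) * run N p m := by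
  have h1 := run_mul_run_shift N hp hm hpi hjm hij.le
  have h2 := run_mul_run_shift N hp hm hpi (j := j - 1) (by omega) (by omega)
  rw [show j - 1 + 1 = j by omega] at h2
  rw [arc, arc, ← mul_assoc, h1, mul_assoc, mul_assoc]
  congr 1
  rw [add_tsub_cancel_right, eq_inv_mul_iff_mul_eq, ← mul_assoc, ← h2, mul_inv_cancel_right]

lemma arc_commute_of_nested (N : ℕ) {p q r s : ℕ} (hp : 1 ≤ p) (hq : q ≤ N) (hpr : p < r)
    (hrs : r < s) (hsq : s < q) : Commute (arc N p q) (arc N r s) := by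
  have h1 := run_mul_arc N hp hq (i := r - 1) (j := s - 1) (by omega) (by omega) (by omega)
  have h2 := run_mul_arc N hp (m := q - 1) (by omega) (i := r - 1) (j := s - 1) (by omega)
    (by omega) (by omega)
  rw [show r - 1 + 1 = r by omega, show s - 1 + 1 = s by omega] at h1 h2
  rw [Commute, SemiconjBy, arc, ← mul_assoc, ← h1, mul_assoc, mul_assoc]
  congr 1
  rw [inv_mul_eq_iff_eq_mul, ← mul_assoc, h2, mul_inv_cancel_right]

/-- The relation `a_{p,q} a_{q,r} = a_{p,r} a_{p,q}`. -/
lemma arc_mul_arc_first (N : ℕ) {p q r : ℕ} (hpq : p < q) (hqr : q < r) :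
    arc N p q * arc N q r = arc N p r * arc N p q := by
  have c1 : Commute (run N p (q - 1)) (run N q r) := run_commute_run N (by omega)
  have c2 : Commute (run N p (q - 1)) (run N q (r - 1)) := run_commute_run N (by omega)
  have e1 := run_mul_run N hpq.le hqr.le
  have e2 := run_mul_run N hpq.le (r := r - 1) (by omega)
  unfold arc
  calc run N p q * (run N p (q - 1))⁻¹ * (run N q r * (run N q (r - 1))⁻¹)
      = run N p q * ((run N p (q - 1))⁻¹ * run N q r) * (run N q (r - 1))⁻¹ := by group
    _ = run N p q * run N q r * ((run N p (q - 1))⁻¹ * (run N q (r - 1))⁻¹) := by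
        rw [c1.inv_left.eq]; group
    _ = run N p r * (run N q (r - 1))⁻¹ * (run N p (q - 1))⁻¹ := by
        rw [e1, c2.inv_left.inv_right.eq, mul_assoc]
    _ = run N p r * (run N p (r - 1))⁻¹ * (run N p q * (run N p (q - 1))⁻¹) := by
        rw [← e2]; group

/-- The relation `a_{p,r} a_{p,q} = a_{q,r} a_{p,r}`. -/
lemma arc_mul_arc_second (N : ℕ) {p q r : ℕ} (hp : 1 ≤ p) (hpq : p < q) (hqr : q < r)
    (hr : r ≤ N) : arc N p r * arc N p q = arc N q r * arc N p r := by
  have c1 : Commute (run N p q) (run N (q + 1) r) := run_commute_run N (by omega)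
  have c2 : Commute (run N (p + 1) q) (run N (q + 1) r) := run_commute_run N (by omega)
  have e1 := run_mul_run N hpq.le hqr.le
  have e2 := run_mul_run N (p := p + 1) (q := q) (r := r) (by omega) hqr.le
  rw [← arc_mul_arc_first N hpq hqr, arc_eq' N hp hpq (by omega), arc_eq' N (by omega) hqr hr,
    arc_eq' N hp (by omega) hr]
  calc (run N (p + 1) q)⁻¹ * run N p q * ((run N (q + 1) r)⁻¹ * run N q r)
      = (run N (p + 1) q)⁻¹ * (run N p q * (run N (q + 1) r)⁻¹) * run N q r := by group
    _ = (run N (p + 1) q)⁻¹ * (run N (q + 1) r)⁻¹ * (run N p q * run N q r) := by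
        rw [c1.inv_right.eq]; group
    _ = (run N (q + 1) r)⁻¹ * (run N (p + 1) q)⁻¹ * run N p r := by
        rw [e1, c2.inv_left.inv_right.eq]
    _ = (run N (q + 1) r)⁻¹ * run N q r * ((run N (p + 1) r)⁻¹ * run N p r) := by
        rw [← e2]; group

/-! ### The rotation -/

lemma rot_mul (N m : ℕ) (x y : BraidGroup N) : rot N m (x * y) = rot N m x * rot N m y := by
  simp [rot, mul_assoc]

lemma rot_one (N m : ℕ) : rot N m 1 = 1 := by simp [rot]

lemma rot_inj {N m : ℕ} {x y : BraidGroup N} (h : rot N m x = rot N m y) : x = y := by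
  simpa [rot] using h

lemma ALetter.hi_rot_le {m : ℕ} {a : ALetter} (ha : a.hi ≤ m) : (a.rot m).hi ≤ m := by
  have := a.lo_lt_hi
  unfold ALetter.rot
  split_ifs <;> simp only <;> omega

lemma rot_aBraid {N m : ℕ} (hm : m ≤ N) {a : ALetter} (ha : a.hi ≤ m) :
    rot N m (aBraid N a) = aBraid N (a.rot m) := by
  have h0 := a.one_le_lo
  have h1 := a.lo_lt_hi
  rw [aBraid_eq_arc, aBraid_eq_arc, rot, mul_inv_eq_iff_eq_mul]
  change run N 1 m * _ = _ * run N 1 m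
  unfold ALetter.rot
  split_ifs with h
  · exact run_mul_arc N le_rfl hm h0 h h1
  · obtain rfl : a.hi = m := by omega
    have e1 := run_mul_run N h0 h1.le
    have e2 := run_mul_run N h0 (Nat.le_succ a.lo)
    have e3 := run_mul_run N (Nat.le_succ a.lo) h1
    rw [arc_eq' N h0 h1 hm, arc, add_tsub_cancel_right, ← e1, ← e2, ← e3]
    group

/-! ### Words and the dual braid monoids -/

lemma wordBraid_nil (N : ℕ) : wordBraid N [] = 1 := rfl

lemma wordBraid_cons (N : ℕ) (a : ALetter) (w : List ALetter) :
    wordBraid N (a :: w) = aBraid N a * wordBraid N w := by simp [wordBraid]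

lemma wordBraid_append (N : ℕ) (v w : List ALetter) :
    wordBraid N (v ++ w) = wordBraid N v * wordBraid N w := by simp [wordBraid]

lemma wordBraid_flatten (N : ℕ) (L : List (List ALetter)) :
    wordBraid N L.flatten = (L.map (wordBraid N)).prod := by
  induction L with
  | nil => rfl
  | cons w L ih => rw [List.flatten_cons, wordBraid_append, ih, List.map_cons, List.prod_cons]

lemma aBraid_mem {N m : ℕ} {a : ALetter} (ha : a.hi ≤ m) : aBraid N a ∈ dualMonoid N m :=
  Submonoid.subset_closure ⟨a, ha, rfl⟩

lemma wordBraid_mem {N m : ℕ} {w : List ALetter} (hw : ∀ a ∈ w, a.hi ≤ m) :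
    wordBraid N w ∈ dualMonoid N m := by
  apply Submonoid.list_prod_mem
  intro x hx
  obtain ⟨a, ha, rfl⟩ := List.mem_map.1 hx
  exact aBraid_mem (hw a ha)

lemma exists_word {N m : ℕ} {x : BraidGroup N} (hx : x ∈ dualMonoid N m) :
    ∃ w : List ALetter, (∀ a ∈ w, a.hi ≤ m) ∧ wordBraid N w = x := by
  induction hx using Submonoid.closure_induction with
  | mem x hx =>
    obtain ⟨a, ha, rfl⟩ := hx
    exact ⟨[a], by simpa using ha, by simp [wordBraid]⟩
  | one => exact ⟨[], by simp, rfl⟩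
  | mul x y _ _ hx hy =>
    obtain ⟨v, hv, rfl⟩ := hx
    obtain ⟨w, hw, rfl⟩ := hy
    refine ⟨v ++ w, fun a ha => ?_, wordBraid_append N v w⟩
    exact (List.mem_append.1 ha).elim (hv a) (hw a)

lemma dualMonoid_mono {N m m' : ℕ} (h : m ≤ m') : dualMonoid N m ≤ dualMonoid N m' :=
  Submonoid.closure_mono fun _ ⟨a, ha, e⟩ => ⟨a, ha.trans h, e⟩

lemma rot_wordBraid {N m : ℕ} (hm : m ≤ N) {w : List ALetter} (hw : ∀ a ∈ w, a.hi ≤ m) :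
    rot N m (wordBraid N w) = wordBraid N (w.map (ALetter.rot m)) := by
  induction w with
  | nil => exact rot_one N m
  | cons a w ih =>
    rw [wordBraid_cons, rot_mul, rot_aBraid hm (hw a (by simp)),
      ih fun c hc => hw c (by simp [hc]), List.map_cons, wordBraid_cons]

lemma hi_rot_iterate_le {m : ℕ} (j : ℕ) {a : ALetter} (ha : a.hi ≤ m) :
    ((ALetter.rot m)^[j] a).hi ≤ m := by
  induction j with
  | zero => exact ha
  | succ j ih => rw [Function.iterate_succ_apply']; exact ALetter.hi_rot_le ih

lemma rot_iterate_wordBraid {N m : ℕ} (hm : m ≤ N) (j : ℕ) {w : List ALetter}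
    (hw : ∀ a ∈ w, a.hi ≤ m) :
    (rot N m)^[j] (wordBraid N w) = wordBraid N (w.map (ALetter.rot m)^[j]) := by
  induction j with
  | zero => simp
  | succ j ih =>
    rw [Function.iterate_succ_apply', ih, rot_wordBraid hm, List.map_map,
      Function.iterate_succ']
    intro a ha
    obtain ⟨c, hc, rfl⟩ := List.mem_map.1 ha
    exact hi_rot_iterate_le j (hw c hc)

lemma rot_mem {N m : ℕ} (hm : m ≤ N) {x : BraidGroup N} (hx : x ∈ dualMonoid N m) :
    rot N m x ∈ dualMonoid N m := by
  obtain ⟨w, hw, rfl⟩ := exists_word hx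
  rw [rot_wordBraid hm hw]
  apply wordBraid_mem
  intro a ha
  obtain ⟨c, hc, rfl⟩ := List.mem_map.1 ha
  exact ALetter.hi_rot_le (hw c hc)

/-- The rotation `ϕ_m` is onto the letters `a_{p,q}` with `q ≤ m`. The last two clauses give the
shape of the preimage: `a_{p-1,q-1}` lies on `m - 1` strands, while `a_{1,q}` comes from
`a_{q-1,m}`. -/
lemma exists_rot_eq {m : ℕ} {a : ALetter} (ha : a.hi ≤ m) :
    ∃ c : ALetter, c.hi ≤ m ∧ c.rot m = a ∧ (2 ≤ a.lo → c.hi < m) ∧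
      (a.lo = 1 → c.lo + 1 = a.hi ∧ c.hi = m) := by
  have h0 := a.one_le_lo
  have h1 := a.lo_lt_hi
  rcases Nat.lt_or_ge 1 a.lo with h | h
  · refine ⟨⟨a.lo - 1, a.hi - 1, by omega, by omega⟩, by simp only; omega, ?_, ?_, by omega⟩
    · rw [ALetter.rot, if_pos (by simp only; omega)]
      ext <;> simp only <;> omega
    · intro _; simp only; omega
  · refine ⟨⟨a.hi - 1, m, by omega, by omega⟩, le_rfl, ?_, by omega, ?_⟩
    · rw [ALetter.rot, if_neg (by simp)]
      ext <;> simp only <;> omega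
    · exact fun _ => ⟨Nat.sub_add_cancel (by omega), rfl⟩

lemma exists_rot_eq_of_mem {N m : ℕ} (hm : m ≤ N) {x : BraidGroup N} (hx : x ∈ dualMonoid N m) :
    ∃ y ∈ dualMonoid N m, rot N m y = x := by
  obtain ⟨w, hw, rfl⟩ := exists_word hx
  clear hx
  induction w with
  | nil => exact ⟨1, one_mem _, rot_one N m⟩
  | cons a w ih =>
    obtain ⟨y, hy, e⟩ := ih fun c hc => hw c (by simp [hc])
    obtain ⟨c, hc, e', -⟩ := exists_rot_eq (hw a (by simp))
    exact ⟨aBraid N c * y, mul_mem (aBraid_mem hc) hy, by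
      rw [rot_mul, rot_aBraid hm hc, e', e, wordBraid_cons]⟩

/-! ### Length -/

/-- The exponent sum `B_N → ℤ`, which sends every `σ_i` to `1`. -/
def expSum (N : ℕ) : BraidGroup N →* Multiplicative ℤ :=
  PresentedGroup.toGroup (f := fun _ => Multiplicative.ofAdd 1) (by
    rintro r (⟨i, j, -, rfl⟩ | ⟨i, j, -, rfl⟩) <;> simp)

lemma expSum_sigma {N i : ℕ} (h1 : 1 ≤ i) (h2 : i < N) :
    expSum N (sigma N i) = Multiplicative.ofAdd 1 := by
  rw [sigma, dif_pos ⟨h1, h2⟩]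
  exact PresentedGroup.toGroup.of _

lemma expSum_aBraid {N : ℕ} {a : ALetter} (ha : a.hi ≤ N) :
    expSum N (aBraid N a) = Multiplicative.ofAdd 1 := by
  have h0 := a.one_le_lo
  have h1 := a.lo_lt_hi
  rw [aBraid, map_mul, map_mul, map_inv, mul_comm, inv_mul_cancel_left,
    expSum_sigma (by omega) (by omega)]

lemma expSum_wordBraid {N : ℕ} {w : List ALetter} (hw : ∀ a ∈ w, a.hi ≤ N) :
    (expSum N (wordBraid N w)).toAdd = w.length := by
  induction w with
  | nil => simp [wordBraid_nil]
  | cons a w ih =>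
    rw [wordBraid_cons, map_mul, toAdd_mul, ih fun c hc => hw c (by simp [hc]),
      expSum_aBraid (hw a (by simp))]
    simp [add_comm]

/-- The length of a positive braid: the exponent sum, truncated to a natural number. On the dual
monoids nothing is lost by the truncation. -/
def len (N : ℕ) (x : BraidGroup N) : ℕ := (expSum N x).toAdd.toNat

lemma len_wordBraid {N m : ℕ} (hm : m ≤ N) {w : List ALetter} (hw : ∀ a ∈ w, a.hi ≤ m) :
    len N (wordBraid N w) = w.length := by
  rw [len, expSum_wordBraid fun a ha => (hw a ha).trans hm, Int.toNat_natCast]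

lemma len_mul {N m : ℕ} (hm : m ≤ N) {x y : BraidGroup N} (hx : x ∈ dualMonoid N m)
    (hy : y ∈ dualMonoid N m) : len N (x * y) = len N x + len N y := by
  obtain ⟨v, hv, rfl⟩ := exists_word hx
  obtain ⟨w, hw, rfl⟩ := exists_word hy
  rw [← wordBraid_append, len_wordBraid hm hv, len_wordBraid hm hw, len_wordBraid hm,
    List.length_append]
  exact fun a ha => (List.mem_append.1 ha).elim (hv a) (hw a)

lemma len_rot (N m : ℕ) (x : BraidGroup N) : len N (rot N m x) = len N x := by
  have h : expSum N (rot N m x) = expSum N x := by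
    rw [rot, map_mul, map_mul, map_inv, mul_comm, inv_mul_cancel_left]
  rw [len, len, h]

lemma len_eq_zero {N m : ℕ} (hm : m ≤ N) {x : BraidGroup N} (hx : x ∈ dualMonoid N m) :
    len N x = 0 ↔ x = 1 := by
  constructor
  · intro h
    obtain ⟨w, hw, rfl⟩ := exists_word hx
    rw [len_wordBraid hm hw, List.length_eq_zero_iff] at h
    rw [h, wordBraid_nil]
  · rintro rfl
    simp [len]

lemma aBraid_ne_one {N : ℕ} {a : ALetter} (ha : a.hi ≤ N) : aBraid N a ≠ 1 := by
  intro h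
  have := expSum_aBraid ha
  rw [h, map_one] at this
  exact absurd (congrArg Multiplicative.toAdd this) (by simp)

/-- `EndsWith N m x a`: the letter `a` is a right divisor of `x` in the dual monoid on `m`
strands. -/
def EndsWith (N m : ℕ) (x : BraidGroup N) (a : ALetter) : Prop :=
  a.hi ≤ m ∧ ∃ g ∈ dualMonoid N m, x = g * aBraid N a

lemma EndsWith.mul_left {N m : ℕ} {x y : BraidGroup N} {a : ALetter} (h : EndsWith N m x a)
    (hy : y ∈ dualMonoid N m) : EndsWith N m (y * x) a := by
  obtain ⟨h1, g, hg, rfl⟩ := h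
  exact ⟨h1, y * g, mul_mem hy hg, (mul_assoc ..).symm⟩

lemma EndsWith.rot {N m : ℕ} (hm : m ≤ N) {x : BraidGroup N} {a : ALetter}
    (h : EndsWith N m x a) : EndsWith N m (rot N m x) (a.rot m) := by
  obtain ⟨h1, g, hg, rfl⟩ := h
  exact ⟨ALetter.hi_rot_le h1, _, rot_mem hm hg, by rw [rot_mul, rot_aBraid hm h1]⟩

lemma EndsWith.mono {N m m' : ℕ} (hm : m ≤ m') {x : BraidGroup N} {a : ALetter}
    (h : EndsWith N m x a) : EndsWith N m' x a := by
  obtain ⟨h1, g, hg, rfl⟩ := h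
  exact ⟨h1.trans hm, g, dualMonoid_mono hm hg, rfl⟩

lemma endsWith_wordBraid {N m : ℕ} {w : List ALetter} (hw : ∀ a ∈ w, a.hi ≤ m) {a : ALetter}
    (ha : w.getLast? = some a) : EndsWith N m (wordBraid N w) a := by
  obtain ⟨v, rfl⟩ := List.getLast?_eq_some_iff.1 ha
  refine ⟨hw a (by simp), wordBraid N v, wordBraid_mem fun c hc => hw c (by simp [hc]), ?_⟩
  simp [wordBraid]

lemma exists_endsWith {N m : ℕ} {x : BraidGroup N} (hx : x ∈ dualMonoid N m) (h1 : x ≠ 1) :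
    ∃ a, EndsWith N m x a := by
  obtain ⟨w, hw, rfl⟩ := exists_word hx
  rcases List.eq_nil_or_concat w with rfl | ⟨v, a, rfl⟩
  · exact absurd rfl h1
  · exact ⟨a, endsWith_wordBraid hw (by simp)⟩

/-! ### Existence of splittings -/

/-- A right divisor of maximal length in the smaller monoid is a tail. -/
lemma exists_isTail {N m : ℕ} (hm : m ≤ N) {x : BraidGroup N} (hx : x ∈ dualMonoid N m) :
    ∃ τ, IsTail N m x τ := by
  let S : Set ℕ := {l | ∃ τ ∈ dualMonoid N (m - 1), ∃ γ ∈ dualMonoid N m, x = γ * τ ∧ len N τ = l}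
  have hS : S.Nonempty := ⟨_, 1, one_mem _, x, hx, (mul_one x).symm, rfl⟩
  have hle : dualMonoid N (m - 1) ≤ dualMonoid N m := dualMonoid_mono (Nat.sub_le m 1)
  have hb : BddAbove S := ⟨len N x, by
    rintro l ⟨τ, hτ, γ, hγ, rfl, rfl⟩
    rw [len_mul hm hγ (hle hτ)]
    omega⟩
  obtain ⟨τ, hτ, γ, hγ, e, hl⟩ := Nat.sSup_mem hS hb
  refine ⟨τ, hτ, γ, hγ, e, ?_⟩
  rintro γ' hγ' ρ hρ rfl
  have h := le_csSup hb (show len N (ρ * τ) ∈ S from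
    ⟨ρ * τ, mul_mem hρ hτ, γ', hγ', by rw [e, mul_assoc], rfl⟩)
  rw [← hl, len_mul hm (hle hρ) (hle hτ)] at h
  exact (len_eq_zero hm (hle hρ)).1 (by omega)

lemma rotProd_succ_self (N m b : ℕ) (β : ℕ → BraidGroup N) : rotProd N m b β (b + 1) = 1 := by
  simp [rotProd]

lemma rotProd_eq (N m b : ℕ) (β : ℕ → BraidGroup N) {k : ℕ} (hk : k ≤ b) :
    rotProd N m b β k = rot N m (rotProd N m b β (k + 1)) * β k := by
  have hmap : ∀ l : List (BraidGroup N), rot N m l.prod = (l.map (rot N m)).prod := fun l => by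
    induction l with
    | nil => exact rot_one N m
    | cons a l ih => rw [List.prod_cons, rot_mul, ih, List.map_cons, List.prod_cons]
  unfold rotProd
  rw [hmap, show b + 1 - k = b + 1 - (k + 1) + 1 by omega, List.range'_succ, List.reverse_cons,
    List.map_append, List.prod_append, List.map_map]
  congr 2
  · apply List.map_congr_left
    intro j hj
    rw [List.mem_reverse, List.mem_range'_1] at hj
    rw [Function.comp_apply, ← Function.iterate_succ_apply' (rot N m),
      show (j - (k + 1)).succ = j - k by omega]
  · simp

lemma rotProd_shift (N m b : ℕ) (β β' : ℕ → BraidGroup N) (h : ∀ j, 1 ≤ j → β (j + 1) = β' j)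
    {k : ℕ} (hk : 1 ≤ k) : rotProd N m (b + 1) β (k + 1) = rotProd N m b β' k := by
  unfold rotProd
  rw [show b + 1 + 1 - (k + 1) = b + 1 - k by omega, Nat.add_comm k 1, ← List.map_add_range',
    List.map_reverse, List.map_reverse, List.map_map]
  congr 2
  apply List.map_congr_left
  intro j hj
  rw [List.mem_range'_1] at hj
  rw [Function.comp_apply, Nat.add_comm 1 j, h j (by omega),
    show j + 1 - (1 + k) = j - k by omega]

/-- A splitting of `ϕ_m⁻¹(γ)`, followed by the tail `τ`, is a splitting of `γ τ`. -/
lemma exists_isSplitting_of_tail {N m : ℕ} {x y τ : BraidGroup N}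
    (hτ : IsTail N m x τ) (e : x = rot N m y * τ) (hy1 : y ≠ 1)
    (hy : ∃ b β, IsSplitting N m y b β) : ∃ b β, IsSplitting N m x b β := by
  obtain ⟨b, β, h⟩ := hy
  have hb : 1 ≤ b := by
    by_contra hb
    obtain rfl : b = 0 := by omega
    exact hy1 (h.eq_prod.trans (rotProd_succ_self N m 0 β))
  let β' : ℕ → BraidGroup N := fun j => if j = 1 then τ else β (j - 1)
  have hβ' : ∀ j, 1 ≤ j → β' (j + 1) = β j := fun j hj => by simp [β', show j ≠ 0 by omega]
  have hx : x = rotProd N m (b + 1) β' 1 := by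
    rw [rotProd_eq N m _ β' (by omega), rotProd_shift N m b β' β hβ' le_rfl, ← h.eq_prod, e]
    simp [β']
  refine ⟨b + 1, β', ⟨?_, ?_, hx, ?_⟩⟩
  · intro k hk hkb
    obtain ⟨k, rfl⟩ := Nat.exists_eq_add_of_le' hk
    rcases Nat.eq_zero_or_pos k with rfl | hk0
    · exact hτ.1
    · rw [hβ' k hk0]; exact h.mem k hk0 (by omega)
  · intro _
    rw [hβ' b hb]; exact h.ne_one hb
  · intro k hk hkb
    obtain ⟨k, rfl⟩ := Nat.exists_eq_add_of_le' hk
    rcases Nat.eq_zero_or_pos k with rfl | hk0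
    · rw [zero_add, ← hx]; exact hτ
    · rw [hβ' k hk0, rotProd_shift N m b β' β hβ' hk0]
      exact h.isTail k hk0 (by omega)

lemma isSplitting_single {N m : ℕ} {x : BraidGroup N} (hx : IsTail N m x x) (h1 : x ≠ 1) :
    IsSplitting N m x 1 fun _ => x := by
  have e : rotProd N m 1 (fun _ => x) 1 = x := by simp [rotProd]
  refine ⟨fun _ _ _ => hx.1, fun _ => h1, e.symm, fun k hk hk1 => ?_⟩
  obtain rfl : k = 1 := by omega
  rw [e]; exact hx

lemma exists_isSplitting {N m : ℕ} (hm3 : 3 ≤ m) (hm : m ≤ N) {x : BraidGroup N}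
    (hx : x ∈ dualMonoid N m) : ∃ b β, IsSplitting N m x b β := by
  induction hl : len N x using Nat.strong_induction_on generalizing x with
  | _ l ih =>
  have hle : dualMonoid N (m - 1) ≤ dualMonoid N m := dualMonoid_mono (Nat.sub_le m 1)
  -- It suffices to split `ϕ_m⁻¹(x)`, and this only when the tail of `x` is trivial.
  have step : ∀ x ∈ dualMonoid N m, len N x = l →
      ((∀ ρ ∈ dualMonoid N (m - 1), ∀ γ ∈ dualMonoid N m, x = γ * ρ → ρ = 1) →
        ∀ y ∈ dualMonoid N m, rot N m y = x → ∃ b β, IsSplitting N m y b β) →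
      ∃ b β, IsSplitting N m x b β := by
    intro x hx hl hy
    by_cases hx1 : x = 1
    · subst hx1
      refine ⟨0, fun _ => 1, ⟨by omega, by omega, ?_, by omega⟩⟩
      exact (rotProd_succ_self N m 0 _).symm
    obtain ⟨τ, hτ⟩ := exists_isTail hm hx
    obtain ⟨hτm, γ, hγ, e, hmax⟩ := id hτ
    obtain ⟨y, hym, rfl⟩ := exists_rot_eq_of_mem hm hγ
    by_cases hy1 : y = 1
    · rw [hy1, rot_one, one_mul] at e
      subst e
      exact ⟨1, _, isSplitting_single hτ hx1⟩
    refine exists_isSplitting_of_tail hτ e hy1 ?_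
    by_cases hτ1 : τ = 1
    · rw [hτ1, mul_one] at e
      subst e
      exact hy (fun ρ hρ γ hγ e => hmax γ hγ ρ hρ e) y hym rfl
    · refine ih (len N y) ?_ hym rfl
      have h0 : len N τ ≠ 0 := fun h => hτ1 ((len_eq_zero hm (hle hτm)).1 h)
      rw [← hl, e, len_mul hm hγ (hle hτm), len_rot]
      omega
  have unrot : ∀ (a c : ALetter) (y : BraidGroup N), c.hi ≤ m → c.rot m = a →
      EndsWith N m (rot N m y) a → EndsWith N m y c := by
    rintro a c y hc rfl ⟨-, g, hg, e⟩
    obtain ⟨g', hg', rfl⟩ := exists_rot_eq_of_mem hm hg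
    rw [← rot_aBraid hm hc, ← rot_mul] at e
    exact ⟨hc, g', hg', rot_inj e⟩
  -- A final letter of the smaller monoid makes the tail nontrivial; two rotations bring every
  -- other letter there.
  have case1 : ∀ x ∈ dualMonoid N m, len N x = l → ∀ a, EndsWith N m x a → a.hi < m →
      ∃ b β, IsSplitting N m x b β := by
    rintro x hx hl a ⟨-, g, hg, e⟩ ha
    refine step x hx hl fun h => ?_
    exact absurd (h _ (aBraid_mem (by omega)) g hg e) (aBraid_ne_one (by omega))
  have case2 : ∀ x ∈ dualMonoid N m, len N x = l → ∀ a, EndsWith N m x a → 2 ≤ a.lo →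
      ∃ b β, IsSplitting N m x b β := by
    intro x hx hl a hxa ha
    refine step x hx hl fun _ y hy e => ?_
    subst e
    obtain ⟨c, hc, ec, hc', -⟩ := exists_rot_eq hxa.1
    exact case1 y hy (by rw [← hl, len_rot]) c (unrot a c y hc ec hxa) (hc' ha)
  refine step x hx hl fun _ y hy e => ?_
  subst e
  by_cases hy1 : y = 1
  · subst hy1
    refine ⟨0, fun _ => 1, ⟨by omega, by omega, ?_, by omega⟩⟩
    exact (rotProd_succ_self N m 0 _).symm
  have hly : len N y = l := by rw [← hl, len_rot]
  obtain ⟨c, hc⟩ := exists_endsWith hy hy1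
  by_cases h2 : 2 ≤ c.lo
  · exact case2 y hy hly c hc h2
  by_cases h3 : c.hi < m
  · exact case1 y hy hly c hc h3
  · refine step y hy hly fun _ z hz e => ?_
    subst e
    obtain ⟨d, hd, ed, -, hd'⟩ := exists_rot_eq hc.1
    have h0 := c.one_le_lo
    have h4 := hc.1
    have := hd' (by omega)
    exact case2 z hz (by rw [← hly, len_rot]) d (unrot c d z hd ed hc) (by omega)

/-! ### Normal forms represent their braids -/

lemma normalForm_spec {N m : ℕ} (hm2 : 2 ≤ m) (hm : m ≤ N) {x : BraidGroup N}
    (hx : x ∈ dualMonoid N m) :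
    (∀ a ∈ normalForm N m x, a.hi ≤ m) ∧ wordBraid N (normalForm N m x) = x := by
  induction m, hm2 using Nat.le_induction generalizing x with
  | base =>
    have h : ∃ k : ℕ, x = aBraid N a12 ^ k := by
      obtain ⟨w, hw, rfl⟩ := exists_word hx
      refine ⟨w.length, ?_⟩
      have : w = List.replicate w.length a12 := by
        refine List.eq_replicate_iff.2 ⟨rfl, fun a ha => ?_⟩
        have h0 := a.one_le_lo
        have h1 := a.lo_lt_hi
        have h2 := hw a ha
        ext <;> simp only [a12] <;> omega
      rw [this]
      simp [wordBraid]
    rw [normalForm, dif_pos h]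
    refine ⟨fun a ha => ?_, ?_⟩
    · rw [List.eq_of_mem_replicate ha]; exact le_rfl
    · simpa [wordBraid] using h.choose_spec.symm
  | succ m hm2 ih =>
    obtain ⟨m, rfl⟩ := Nat.exists_eq_add_of_le' hm2
    have h : ∃ s : ℕ × (ℕ → BraidGroup N), IsSplitting N (m + 3) x s.1 s.2 := by
      obtain ⟨b, β, h⟩ := exists_isSplitting (by omega) hm hx
      exact ⟨(b, β), h⟩
    have hs := h.choose_spec
    change IsSplitting N (m + 3) x _ _ at hs
    change (∀ a ∈ normalForm N (m + 3) x, a.hi ≤ m + 3) ∧ wordBraid N (normalForm N (m + 3) x) = x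
    rw [normalForm, dif_pos h]
    set b := h.choose.1
    set β := h.choose.2
    have hβ : ∀ j, 1 ≤ j → j ≤ b → (∀ a ∈ normalForm N (m + 2) (β j), a.hi ≤ m + 2) ∧
        wordBraid N (normalForm N (m + 2) (β j)) = β j := fun j h1 h2 =>
      ih (by omega) (hs.mem j h1 h2)
    constructor
    · intro a ha
      simp only [List.mem_flatten, List.mem_map, List.mem_reverse, List.mem_range'_1] at ha
      obtain ⟨_, ⟨j, hj, rfl⟩, ha⟩ := ha
      obtain ⟨c, hc, rfl⟩ := List.mem_map.1 ha
      exact hi_rot_iterate_le _ (((hβ j (by omega) (by omega)).1 c hc).trans (by omega))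
    · rw [wordBraid_flatten, List.map_map]
      conv_rhs => rw [hs.eq_prod]
      unfold rotProd
      rw [add_tsub_cancel_right]
      congr 1
      apply List.map_congr_left
      intro j hj
      rw [List.mem_reverse, List.mem_range'_1] at hj
      have := hβ j (by omega) (by omega)
      rw [Function.comp_apply, ← rot_iterate_wordBraid hm _
        fun a ha => (this.1 a ha).trans (by omega), this.2]

/-! ### Barriers and ladders -/

/-- A letter that is either contained in the first `s` strands or equal to `a_{s,n}` can be moved
to the right across any word on `n - 1` strands without `a_{s,n}`-barrier, up to changing it into
another letter of this kind. -/
lemma exists_endsWith_of_no_barrier {N n s : ℕ} (hn : n ≤ N) {w : List ALetter}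
    (hw : ∀ c ∈ w, c.hi ≤ n - 1) (hb : ∀ c ∈ w, ¬ IsBarrier n s c) {a : ALetter} (han : a.hi ≤ n)
    (ha : a.hi ≤ s ∨ (a.lo = s ∧ a.hi = n)) :
    ∃ a' : ALetter, (a'.hi ≤ s ∨ (a'.lo = s ∧ a'.hi = n)) ∧
      EndsWith N n (aBraid N a * wordBraid N w) a' := by
  induction w generalizing a with
  | nil => exact ⟨a, ha, han, 1, one_mem _, by simp [wordBraid_nil]⟩
  | cons c w ih =>
    have hc := hw c (by simp)
    have hcb := hb c (by simp)
    have ih' := @ih (fun d hd => hw d (by simp [hd])) (fun d hd => hb d (by simp [hd]))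
    have h0 := c.one_le_lo
    have h1 := c.lo_lt_hi
    have h2 := a.one_le_lo
    have h3 := a.lo_lt_hi
    rw [wordBraid_cons]
    by_cases hcs : c.hi ≤ s
    · obtain ⟨a', ha', h⟩ := ih' (by omega) (Or.inl hcs)
      exact ⟨a', ha', h.mul_left (aBraid_mem han)⟩
    have hsc : s ≤ c.lo := by
      by_contra h
      exact hcb ⟨h0, by omega, by omega, hc⟩
    -- Here `c` is a letter on the strands `s, …, n - 1`, and `a` passes it unchanged.
    have key : ∃ d : ALetter, d.hi ≤ n ∧ aBraid N a * aBraid N c = aBraid N d * aBraid N a := by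
      rcases ha with ha | ⟨ha, ha'⟩
      · rcases Nat.lt_or_ge a.hi c.lo with h | h
        · exact ⟨c, by omega, by
            simpa only [aBraid_eq_arc] using (arc_commute_of_lt N h).eq⟩
        · have e : c.lo = a.hi := by omega
          refine ⟨⟨a.lo, c.hi, h2, by omega⟩, by simp only; omega, ?_⟩
          simp only [aBraid_eq_arc, e]
          exact arc_mul_arc_first N h3 (by omega)
      · rcases Nat.lt_or_ge a.lo c.lo with h | h
        · exact ⟨c, by omega, by
            simpa only [aBraid_eq_arc] using
              (arc_commute_of_nested N h2 (by omega) h h1 (by omega)).eq⟩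
        · have e : c.lo = a.lo := by omega
          refine ⟨⟨c.hi, a.hi, by omega, by omega⟩, by simp only; omega, ?_⟩
          simp only [aBraid_eq_arc, e]
          exact arc_mul_arc_second N h2 (by omega) (by omega) (by omega)
    obtain ⟨d, hd, e⟩ := key
    obtain ⟨a', ha', h⟩ := ih' han ha
    refine ⟨a', ha', ?_⟩
    rw [← mul_assoc, e, mul_assoc]
    exact h.mul_left (aBraid_mem hd)

/-- The combinatorial part of the ladder property: a word has the shape of an `a_{p,n}`-ladder as
soon as it contains an `a_{p,n}`-barrier (for `p < n - 1`) and each of its letters `a_{r,s}` with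
`s < n - 1` is followed by some `a_{s,n}`-barrier. -/
lemma exists_ladder_decomposition {n p : ℕ} {w : List ALetter} (hpn : p ≤ n - 1)
    (hw : ∀ v a v', w = v ++ a :: v' → a.hi < n - 1 → ∃ c ∈ v', IsBarrier n a.hi c)
    (hp : p < n - 1 → ∃ c ∈ w, IsBarrier n p c) :
    ∃ (h : ℕ) (u : ℕ → List ALetter) (x : ℕ → ALetter) (f : ℕ → ℕ),
      w = u 0 ++ ((List.range' 1 h).map fun k => x k :: u k).flatten ∧
      f 0 = p ∧ f h = n - 1 ∧ (∀ k < h, f k < f (k + 1)) ∧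
      (∀ k, 1 ≤ k → k ≤ h → IsBarrier n (f (k - 1)) (x k) ∧ (x k).hi = f k) ∧
      (∀ k < h, ∀ a ∈ u k, ¬ IsBarrier n (f k) a) := by
  induction w generalizing p with
  | nil =>
    have : p = n - 1 := by
      by_contra h
      obtain ⟨c, hc, -⟩ := hp (by omega)
      simp at hc
    exact ⟨0, fun _ => [], fun _ => a12, fun _ => p, by simp, rfl, this, by simp,
      by omega, by simp⟩
  | cons c w ih =>
    rcases hpn.eq_or_lt with rfl | hlt
    · exact ⟨0, fun _ => c :: w, fun _ => c, fun _ => n - 1, by simp, rfl, rfl, by simp,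
        by omega, by simp⟩
    have hw' : ∀ v a v', w = v ++ a :: v' → a.hi < n - 1 → ∃ c ∈ v', IsBarrier n a.hi c :=
      fun v a v' e => hw (c :: v) a v' (by rw [e, List.cons_append])
    by_cases hc : IsBarrier n p c
    · obtain ⟨h, u, x, f, e, f0, fh, hf, hx, hu⟩ := ih hc.2.2.2 hw' (hw [] c w rfl)
      refine ⟨h + 1, fun k => k.casesOn [] u, fun k => if k = 1 then c else x (k - 1),
        fun k => k.casesOn p f, ?_, rfl, fh, ?_, ?_, ?_⟩
      · rw [List.range'_succ, List.map_cons, List.flatten_cons, ← List.map_add_range', List.map_map,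
          e]
        simp only [if_true, List.cons_append]
        congr 3
        apply List.map_congr_left
        intro k hk
        rw [List.mem_range'_1] at hk
        rw [Function.comp_apply, Nat.add_comm 1 k, if_neg (by omega), add_tsub_cancel_right]
      · rintro (_ | k) hk
        · change p < f 0
          rw [f0]; exact hc.2.2.1
        · exact hf k (by omega)
      · rintro (_ | _ | k) h1 h2
        · omega
        · exact ⟨hc, f0.symm⟩
        · exact hx (k + 1) (by omega) (by omega)
      · rintro (_ | k) hk a ha
        · exact absurd ha (by simp)
        · exact hu k (by omega) a ha
    · have hp' : p < n - 1 → ∃ c ∈ w, IsBarrier n p c := fun h => by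
        obtain ⟨d, hd, hdb⟩ := hp h
        rcases List.mem_cons.1 hd with rfl | hd
        · exact absurd hdb hc
        · exact ⟨d, hd, hdb⟩
      obtain ⟨h, u, x, f, e, f0, fh, hf, hx, hu⟩ := ih hpn hw' hp'
      refine ⟨h, fun k => if k = 0 then c :: u 0 else u k, x, f, ?_, f0, fh, hf, hx, ?_⟩
      · simp only [if_true, List.cons_append]
        congr 1
        rw [e]
        congr 2
        apply List.map_congr_left
        intro k hk
        rw [List.mem_range'_1] at hk
        rw [if_neg (by omega)]
      · intro k hk a ha
        dsimp only at ha
        split_ifs at ha with hk0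
        · subst hk0
          rcases List.mem_cons.1 ha with rfl | ha
          · rw [f0]; exact hc
          · exact hu 0 hk a ha
        · exact hu k hk a ha

/-! ### The entries of a splitting -/

variable {n : ℕ} {x : BraidGroup n} {b : ℕ} {β : ℕ → BraidGroup n}

/-- The quotient of `rotProd n n b β k` by its tail `β k` is `ϕ_n(rotProd n n b β (k + 1))`, which
therefore ends only with letters `a_{p,n}`. -/
lemma IsSplitting.rot_spec (hβ : IsSplitting n n x b β) {k : ℕ} (hk : 1 ≤ k) (hkb : k ≤ b) :
    rot n n (rotProd n n b β (k + 1)) ∈ dualMonoid n n ∧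
      ∀ a, EndsWith n n (rot n n (rotProd n n b β (k + 1))) a → a.hi = n := by
  obtain ⟨-, γ, hγ, e, hmax⟩ := hβ.isTail k hk hkb
  rw [rotProd_eq n n b β hkb, mul_left_inj] at e
  rw [e]
  refine ⟨hγ, ?_⟩
  rintro a ⟨ha, g, hg, eg⟩
  by_contra h
  exact aBraid_ne_one ha (hmax g hg _ (aBraid_mem (by omega)) eg)

lemma IsSplitting.rotProd_mem (hβ : IsSplitting n n x b β) {k : ℕ} (hk : 1 ≤ k) (hkb : k ≤ b) :
    rotProd n n b β k ∈ dualMonoid n n := by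
  rw [rotProd_eq n n b β hkb]
  exact mul_mem (hβ.rot_spec hk hkb).1 (dualMonoid_mono (Nat.sub_le n 1) (hβ.mem k hk hkb))

lemma IsSplitting.rotProd_ne_one (hβ : IsSplitting n n x b β) {k : ℕ} (hk : 1 ≤ k)
    (hkb : k ≤ b) : rotProd n n b β k ≠ 1 := by
  induction hkb using Nat.decreasingInduction with
  | self =>
    rw [rotProd_eq n n b β le_rfl, rotProd_succ_self, rot_one, one_mul]
    exact hβ.ne_one hk
  | of_succ k hkb ih =>
    intro h
    have h1 := (hβ.rot_spec hk hkb.le).1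
    have h2 := dualMonoid_mono (Nat.sub_le n 1) (hβ.mem k hk hkb.le)
    rw [rotProd_eq n n b β hkb.le] at h
    have h3 := len_mul le_rfl h1 h2
    rw [h, (len_eq_zero le_rfl (one_mem (dualMonoid n n))).2 rfl, len_rot] at h3
    exact ih (by omega) ((len_eq_zero le_rfl (hβ.rotProd_mem (by omega) (by omega))).1 (by omega))

/-- For `k ≥ 2` the tail condition at `k - 1` restricts the final letters of
`ϕ_n^{b-k}(β_b) ⋯ β_k`: the rotation has to turn them into letters `a_{p,n}`. -/
lemma IsSplitting.endsWith_rotProd (hβ : IsSplitting n n x b β) {k : ℕ} (hk : 2 ≤ k)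
    (hkb : k ≤ b) {a : ALetter} (ha : EndsWith n n (rotProd n n b β k) a) :
    a.hi = n - 1 ∨ (a.lo = n - 1 ∧ a.hi = n) := by
  obtain ⟨k, rfl⟩ := Nat.exists_eq_add_of_le' (show 1 ≤ k by omega)
  have h := (hβ.rot_spec (k := k) (by omega) (by omega)).2 _ (ha.rot le_rfl)
  have h1 := ha.1
  unfold ALetter.rot at h
  split_ifs at h <;> simp only at h <;> omega

/-- In a word for `β_k`, `k ≥ 2`, every letter `a_{r,s}` with `s < n - 1` is followed by an
`a_{s,n}`-barrier; likewise the whole word contains an `a_{s,n}`-barrier if it is preceded by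
`a_{s,n}`. -/
lemma IsSplitting.exists_barrier (hβ : IsSplitting n n x b β) {k : ℕ} (hk : 2 ≤ k) (hkb : k ≤ b)
    {s : ℕ} (hs : s < n - 1) {g : BraidGroup n} (hg : g ∈ dualMonoid n n) {a : ALetter}
    (han : a.hi ≤ n) (ha : a.hi ≤ s ∨ (a.lo = s ∧ a.hi = n)) {w : List ALetter}
    (hw : ∀ c ∈ w, c.hi ≤ n - 1)
    (e : rotProd n n b β k = g * (aBraid n a * wordBraid n w)) : ∃ c ∈ w, IsBarrier n s c := by
  by_contra! hb
  obtain ⟨a', ha', h⟩ := exists_endsWith_of_no_barrier le_rfl hw hb han ha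
  have := hβ.endsWith_rotProd hk hkb (e ▸ h.mul_left hg)
  have h1 := a'.lo_lt_hi
  omega

/-- If `β_j = 1`, then `ϕ_n^{b-j}(β_b) ⋯ β_j` ends with `a_{n-1,n}`, because both tail conditions
apply to its final letter. So the next product has the form `g a_{1,n} β_{j-1}`, and as there are
no `a_{1,n}`-barriers, it ends with `a_{1,n}`, which is excluded. -/
lemma IsSplitting.entry_ne_one (hn : 3 ≤ n) (hβ : IsSplitting n n x b β) {j : ℕ} (hj : 3 ≤ j)
    (hjb : j ≤ b) : β j ≠ 1 := by
  intro h1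
  obtain ⟨a, ha⟩ := exists_endsWith (hβ.rotProd_mem (by omega) hjb)
    (hβ.rotProd_ne_one (by omega) hjb)
  have ha1 := hβ.endsWith_rotProd (by omega) hjb ha
  have ha2 : a.hi = n := by
    rw [rotProd_eq n n b β hjb, h1, mul_one] at ha
    exact (hβ.rot_spec (by omega) hjb).2 a ha
  obtain ⟨k, rfl⟩ := Nat.exists_eq_add_of_le' (show 1 ≤ j by omega)
  obtain ⟨har, g, hg, e⟩ := ha.rot le_rfl
  obtain ⟨w, hw, ew⟩ := exists_word (hβ.mem k (by omega) (by omega))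
  have hrot : a.rot n = ⟨1, a.lo + 1, le_rfl, by omega⟩ := by
    rw [ALetter.rot, if_neg (by omega)]
  obtain ⟨c, -, hc⟩ := hβ.exists_barrier (k := k) (by omega) (by omega) (s := 1) (by omega) hg har
    (Or.inr ⟨by rw [hrot], by rw [hrot]; change a.lo + 1 = n; omega⟩) hw
    (by rw [rotProd_eq n n b β (by omega), e, ew, mul_assoc])
  have := hc.1
  have := hc.2.1
  omega

end DualBraid

end

open DualBraid
theorem corollary3p10 (n : ℕ) (hn : 3 ≤ n) (x : BraidGroup n) (hx : x ∈ dualMonoid n n)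
    (b : ℕ) (β : ℕ → BraidGroup n) (hβ : IsSplitting n n x b β)
    (k : ℕ) (hk : 2 ≤ k) (hkb : k + 1 ≤ b) :
    ∃ y : ALetter, lastLetter n (n - 1) (β (k + 1)) = some y ∧ (y.rot n).hi = n ∧
      (β k ≠ 1 → ∃ z : ALetter, lastLetter n (n - 1) (β k) = some z ∧
        ∃ h : ℕ, IsLadder n (y.rot n).lo h z (normalForm n (n - 1) (β k))) ∧
      (β k = 1 → k = 2 ∧ normalForm n (n - 1) (β k) = [] ∧ (y.rot n).lo = n - 1) := by
  have getLast : ∀ j, 1 ≤ j → j ≤ b → β j ≠ 1 →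
      ∃ y, lastLetter n (n - 1) (β j) = some y ∧ EndsWith n (n - 1) (β j) y := by
    intro j h1 h2 h3
    obtain ⟨hlet, hword⟩ := normalForm_spec (by omega) (Nat.sub_le n 1) (hβ.mem j h1 h2)
    rcases h : (normalForm n (n - 1) (β j)).getLast? with _ | y
    · rw [List.getLast?_eq_none_iff] at h
      rw [h] at hword
      exact absurd hword.symm h3
    · exact ⟨y, h, hword ▸ endsWith_wordBraid hlet h⟩
  have endProd : ∀ j, 1 ≤ j → j ≤ b → ∀ a, EndsWith n (n - 1) (β j) a →
      EndsWith n n (rotProd n n b β j) a := by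
    intro j h1 h2 a ha
    rw [rotProd_eq n n b β h2]
    exact (ha.mono (Nat.sub_le n 1)).mul_left (hβ.rot_spec h1 h2).1
  obtain ⟨y, hy, hye⟩ := getLast (k + 1) (by omega) hkb (hβ.entry_ne_one hn (by omega) hkb)
  have hyr := (endProd (k + 1) (by omega) hkb y hye).rot le_rfl
  have hyn := (hβ.rot_spec (by omega) (by omega)).2 _ hyr
  have hyl := (y.rot n).lo_lt_hi
  obtain ⟨hlet, hword⟩ := normalForm_spec (by omega) (Nat.sub_le n 1)
    (hβ.mem k (by omega) (by omega))
  refine ⟨y, hy, hyn, fun hk1 => ?_, fun hk1 => ⟨?_, ?_, ?_⟩⟩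
  · obtain ⟨z, hz, hze⟩ := getLast k (by omega) (by omega) hk1
    have hzn : z.hi = n - 1 := by
      have h1 := hβ.endsWith_rotProd hk (by omega) (endProd k (by omega) (by omega) z hze)
      have h2 := hze.1
      omega
    obtain ⟨-, g, hg, e⟩ := hyr
    have hP : rotProd n n b β k = g * (aBraid n (y.rot n) *
        wordBraid n (normalForm n (n - 1) (β k))) := by
      rw [rotProd_eq n n b β (by omega), e, hword, mul_assoc]
    obtain ⟨h, u, l, f, hl⟩ := exists_ladder_decomposition (n := n) (p := (y.rot n).lo)
      (w := normalForm n (n - 1) (β k)) (by omega)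
      (fun v a v' ev ha => by
        rw [ev] at hlet
        refine hβ.exists_barrier hk (by omega) ha
          (g := g * aBraid n (y.rot n) * wordBraid n v) ?_ (by omega) (Or.inl le_rfl)
          (fun c hc => hlet c (by simp [hc])) ?_
        · exact mul_mem (mul_mem hg (aBraid_mem hyn.le)) (wordBraid_mem fun c hc =>
            (hlet c (by simp [hc])).trans (Nat.sub_le n 1))
        · rw [hP, ev, wordBraid_append, wordBraid_cons]
          simp only [mul_assoc])
      (fun hp => hβ.exists_barrier hk (by omega) hp hg hyn.le (Or.inr ⟨rfl, hyn⟩) hlet hP)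
    refine ⟨z, hz, h, ⟨hlet, by rw [hword]⟩, u, l, f, hl.1, hl.2.1, hl.2.2.1, hl.2.2.2.1,
      hl.2.2.2.2.1, hl.2.2.2.2.2, hz, hzn⟩
  · by_contra h
    exact hβ.entry_ne_one hn (show 3 ≤ k by omega) (by omega) hk1
  · have h1 := len_wordBraid (Nat.sub_le n 1) hlet
    rw [hword, (len_eq_zero (Nat.sub_le n 1) (hβ.mem k (by omega) (by omega))).2 hk1] at h1
    exact List.length_eq_zero_iff.1 h1.symm
  · have h1 : rotProd n n b β k = rot n n (rotProd n n b β (k + 1)) := by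
      rw [rotProd_eq n n b β (by omega), hk1, mul_one]
    have h2 := hβ.endsWith_rotProd hk (by omega) (h1 ▸ hyr)
    omega
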